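/- Let $m>0$, let $A$ be the area measure on $\mathbb{C}$, and let $d\mu_m(z)=\frac1\pi e^{-m|z|^2}\,dA(z)$. Let $\mathcal{F}_m$ be the Fock space of all entire functions in $L^2(\mu_m)$. For an integer $N\ge 1$ let $$S^{N,m}=\overline{\operatorname{span}\{\bar z^j z^k:\ 0\le j\le N-1,\ k\ge j\}}^{\,L^2(\mu_m)},$$ and let $P_{S^{N,m}}$ be the orthogonal projection of $L^2(\mu_m)$ onto $S^{N,m}$. Let $g$ be an entire function such that $z^n g\in L^2(\mu_m)$ for all integers $n\ge 0$, and let $H^{Y_N}_{\bar g}$ be the middle Hankel operator $$H^{Y_N}_{\bar g}f=(I-P_{S^{N,m}})(\bar g f),$$ defined for analytic polynomials $f$ (which form a dense subspace of $\mathcal{F}_m$). Then: 1. $H^{Y_N}_{\bar g}$ extends to a bounded operator from $\mathcal{F}_m$ to $L^2(\mu_m)$ if and only if $g$ is a polynomial of degree at most $N$; 2. $H^{Y_N}_{\bar g}$ extends to a compact operator from $\mathcal{F}_m$ to $L^2(\mu_m)$ if and only if $g$ is a polynomial of degree strictly smaller than $N$. Here the zero polynomial counts as a polynomial of degree smaller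 than $N$. -/

import Mathlib

open MeasureTheory Polynomial
open scoped ComplexConjugate

noncomputable section

/-- The Gaussian measure `dμ_m(z) = π⁻¹ exp(-m|z|²) dA(z)` on `ℂ`, with `A` the area measure. -/
def fockMeasure (m : ℝ) : Measure ℂ :=
  volume.withDensity fun z => ENNReal.ofReal (Real.pi⁻¹ * Real.exp (-m * ‖z‖ ^ 2))

/-- The Hilbert space `L²(μ_m)`. -/
abbrev FockL2 (m : ℝ) : Type := Lp ℂ 2 (fockMeasure m)

/-- The Fock space `F_m`: the classes in `L²(μ_m)` of the square integrable entire functions. -/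
def fockSpace (m : ℝ) : Submodule ℂ (FockL2 m) where
  carrier := {u | ∃ f : ℂ → ℂ, Differentiable ℂ f ∧ u =ᵐ[fockMeasure m] f}
  add_mem' := by
    rintro u v ⟨f, hf, hu⟩ ⟨h, hh, hv⟩
    exact ⟨f + h, hf.add hh, (Lp.coeFn_add u v).trans (hu.add hv)⟩
  zero_mem' := ⟨0, differentiable_const 0, Lp.coeFn_zero ℂ 2 (fockMeasure m)⟩
  smul_mem' := by
    rintro c u ⟨f, hf, hu⟩
    exact ⟨c • f, hf.const_smul c, (Lp.coeFn_smul c u).trans (hu.const_smul c)⟩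

/-- The functions `z̄ ^ j * z ^ k` lie in `L²(μ_m)`. -/
theorem memLp_monomial {m : ℝ} (hm : 0 < m) (j k : ℕ) :
    MemLp (fun z : ℂ => conj z ^ j * z ^ k) 2 (fockMeasure m) := by
  have hc : Continuous (fun z : ℂ => conj z ^ j * z ^ k) := by fun_prop
  rw [memLp_two_iff_integrable_sq_norm hc.aestronglyMeasurable, fockMeasure,
    integrable_withDensity_iff (by fun_prop) (by simp)]
  have hG : Integrable (fun z : ℂ => Real.exp (-(m / 2) * ‖z‖ ^ 2)) := by
    have h := GaussianFourier.integrable_cexp_neg_mul_sq_norm_add (V := ℂ)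
      (b := ((m / 2 : ℝ) : ℂ)) (by simpa using hm) 0 0
    refine h.norm.congr (Filter.Eventually.of_forall fun z => ?_)
    simp only [Complex.norm_exp]
    congr 1
    simp [← Complex.ofReal_pow]
  set n := j + k with hn
  refine (hG.const_mul (Real.pi⁻¹ * ((n.factorial : ℝ) * (2 / m) ^ n))).mono'
    (Continuous.aestronglyMeasurable ?_) (Filter.Eventually.of_forall fun z => ?_)
  · have : Continuous fun z : ℂ => (ENNReal.ofReal (Real.pi⁻¹ * Real.exp (-m * ‖z‖ ^ 2))).toReal := by
      have h0 : ∀ z : ℂ, (ENNReal.ofReal (Real.pi⁻¹ * Real.exp (-m * ‖z‖ ^ 2))).toReal =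
          Real.pi⁻¹ * Real.exp (-m * ‖z‖ ^ 2) := fun z =>
        ENNReal.toReal_ofReal (by positivity)
      simp only [h0]
      fun_prop
    exact (hc.norm.pow 2).mul this
  · rw [ENNReal.toReal_ofReal (by positivity), Real.norm_of_nonneg (by positivity)]
    have h1 : ‖conj z ^ j * z ^ k‖ ^ 2 = (‖z‖ ^ 2) ^ n := by
      rw [norm_mul, norm_pow, norm_pow, RCLike.norm_conj, ← pow_add, ← hn]
      ring
    have h2 := Real.pow_div_factorial_le_exp (m / 2 * ‖z‖ ^ 2) (by positivity) n
    have h3 : (‖z‖ ^ 2) ^ n ≤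
        (n.factorial : ℝ) * (2 / m) ^ n * Real.exp (m / 2 * ‖z‖ ^ 2) := by
      have h4 : (‖z‖ ^ 2) ^ n = (2 / m) ^ n * (m / 2 * ‖z‖ ^ 2) ^ n := by
        rw [← mul_pow]
        congr 1
        field_simp
      rw [div_le_iff₀ (by positivity)] at h2
      rw [h4]
      calc (2 / m) ^ n * (m / 2 * ‖z‖ ^ 2) ^ n
          ≤ (2 / m) ^ n * (Real.exp (m / 2 * ‖z‖ ^ 2) * n.factorial) := by gcongr
        _ = _ := by ring
    have h5 : Real.exp (-(m / 2) * ‖z‖ ^ 2) =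
        Real.exp (m / 2 * ‖z‖ ^ 2) * Real.exp (-m * ‖z‖ ^ 2) := by
      rw [← Real.exp_add]
      congr 1
      ring
    rw [h1, h5]
    calc (‖z‖ ^ 2) ^ n * (Real.pi⁻¹ * Real.exp (-m * ‖z‖ ^ 2))
        ≤ ((n.factorial : ℝ) * (2 / m) ^ n * Real.exp (m / 2 * ‖z‖ ^ 2)) *
          (Real.pi⁻¹ * Real.exp (-m * ‖z‖ ^ 2)) := by gcongr
      _ = _ := by ring

/-- Analytic polynomials lie in `L²(μ_m)`. -/
theorem memLp_polynomial {m : ℝ} (hm : 0 < m) (p : ℂ[X]) :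
    MemLp (fun z : ℂ => p.eval z) 2 (fockMeasure m) := by
  simp only [eval_eq_sum_range]
  refine memLp_finsetSum _ fun i _ => ?_
  simpa using (memLp_monomial hm 0 i).const_mul (p.coeff i)

/-- If `z ^ n * g ∈ L²(μ_m)` for all `n`, then `conj g * p ∈ L²(μ_m)` for every polynomial `p`. -/
theorem memLp_conj_mul_polynomial {m : ℝ} {g : ℂ → ℂ}
    (hg : ∀ n : ℕ, MemLp (fun z => z ^ n * g z) 2 (fockMeasure m)) (p : ℂ[X]) :
    MemLp (fun z : ℂ => conj (g z) * p.eval z) 2 (fockMeasure m) := by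
  have h0 : MemLp g 2 (fockMeasure m) := by simpa using hg 0
  simp only [eval_eq_sum_range, Finset.mul_sum]
  refine memLp_finsetSum _ fun i _ => ?_
  refine ((hg i).const_mul (p.coeff i)).of_le
    ((Complex.continuous_conj.comp_aestronglyMeasurable h0.1).mul
      (by fun_prop)) (Filter.Eventually.of_forall fun z => ?_)
  simp only [norm_mul, RCLike.norm_conj]
  exact le_of_eq (by ring)

/-- The inclusion of the analytic polynomials in the Fock space `F_m`. -/
def polyToFock {m : ℝ} (hm : 0 < m) : ℂ[X] →ₗ[ℂ] fockSpace m where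
  toFun p := ⟨(memLp_polynomial hm p).toLp, fun z => p.eval z, p.differentiable,
    (memLp_polynomial hm p).coeFn_toLp⟩
  map_add' p q := by
    refine Subtype.ext ?_
    refine Eq.trans ?_ (MemLp.toLp_add (memLp_polynomial hm p) (memLp_polynomial hm q))
    exact MemLp.toLp_congr (memLp_polynomial hm (p + q)) _ (Filter.Eventually.of_forall fun z => by simp)
  map_smul' c p := by
    refine Subtype.ext ?_
    refine Eq.trans ?_ (MemLp.toLp_const_smul c (memLp_polynomial hm p))
    exact MemLp.toLp_congr (memLp_polynomial hm (c • p)) _ (Filter.Eventually.of_forall fun z => by simp)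

/-- Multiplication by `conj g`, from the analytic polynomials to `L²(μ_m)`. -/
def conjMul {m : ℝ} {g : ℂ → ℂ}
    (hg : ∀ n : ℕ, MemLp (fun z => z ^ n * g z) 2 (fockMeasure m)) : ℂ[X] →ₗ[ℂ] FockL2 m where
  toFun p := (memLp_conj_mul_polynomial hg p).toLp
  map_add' p q := by
    refine Eq.trans ?_
      (MemLp.toLp_add (memLp_conj_mul_polynomial hg p) (memLp_conj_mul_polynomial hg q))
    exact MemLp.toLp_congr _ _ (Filter.Eventually.of_forall fun z => by simp [mul_add])
  map_smul' c p := by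
    refine Eq.trans ?_ (MemLp.toLp_const_smul c (memLp_conj_mul_polynomial hg p))
    exact MemLp.toLp_congr _ _ (Filter.Eventually.of_forall fun z => by
      simp [mul_left_comm])

/-- The closed subspace `S^{N,m}` of `L²(μ_m)`: the closure of the linear span of the
functions `z̄ ^ j * z ^ k` with `0 ≤ j ≤ N - 1` and `k ≥ j`. -/
def subspaceS {m : ℝ} (hm : 0 < m) (N : ℕ) : Submodule ℂ (FockL2 m) :=
  (Submodule.span ℂ
    {u : FockL2 m | ∃ j k : ℕ, j < N ∧ j ≤ k ∧ u = (memLp_monomial hm j k).toLp}).topologicalClosure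

instance subspaceS_completeSpace {m : ℝ} (hm : 0 < m) (N : ℕ) :
    CompleteSpace (subspaceS hm N) := by
  unfold subspaceS
  infer_instance

/-- The middle Hankel operator `f ↦ (I - P_S)(conj g * f)`, `S = S^{N,m}`, defined on the
analytic polynomials; `P_S` is the orthogonal projection of `L²(μ_m)` onto `S`. -/
def middleHankel {m : ℝ} (hm : 0 < m) (N : ℕ) {g : ℂ → ℂ}
    (hg : ∀ n : ℕ, MemLp (fun z => z ^ n * g z) 2 (fockMeasure m)) : ℂ[X] →ₗ[ℂ] FockL2 m :=
  ((ContinuousLinearMap.id ℂ (FockL2 m) - (subspaceS hm N).starProjection :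
    FockL2 m →L[ℂ] FockL2 m) : FockL2 m →ₗ[ℂ] FockL2 m) ∘ₗ conjMul hg

/-- The operator `H`, given on the analytic polynomials, extends to a bounded operator
from `F_m` to `L²(μ_m)`. -/
def ExtendsToBounded {m : ℝ} (hm : 0 < m) (H : ℂ[X] →ₗ[ℂ] FockL2 m) : Prop :=
  ∃ T : fockSpace m →L[ℂ] FockL2 m, ∀ p : ℂ[X], T (polyToFock hm p) = H p

/-- The operator `H`, given on the analytic polynomials, extends to a compact operator
from `F_m` to `L²(μ_m)`. -/
def ExtendsToCompact {m : ℝ} (hm : 0 < m) (H : ℂ[X] →ₗ[ℂ] FockL2 m) : Prop :=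
  ∃ T : fockSpace m →L[ℂ] FockL2 m,
    (∀ p : ℂ[X], T (polyToFock hm p) = H p) ∧ IsCompactOperator T

end

/-! Write g = Σ c_d z^d. For each l ≥ 0 let L_l be z^l times the monic Laguerre polynomial of degree
N and parameter l in |z|², rescaled to the weight. By rotation invariance and Laguerre
orthogonality, L_l is orthogonal to S, and it differs from z̄^N z^(N+l) by an element of S. Hence (I
- P_S)(z̄^N z^(N+l)) = L_l.

Necessity: pairing H(z^(d+l)) with L_l isolates c_d. Relative to the norms, the squared pairing is a
constant times |c_d|² (l+N+1)⋯(l+d), which is unbounded in l when d > N unless c_d = 0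
(`coeff_eq_zero_of_extendsToBounded`).

Sufficiency: if deg g ≤ N, then H(z^(N+l)) = conj(c_N) L_l, the L_l are pairwise orthogonal, and
‖L_l‖ / ‖z^(N+l)‖ does not depend on l (`norm_laguerreVec`). So H is a finite rank operator plus
conj(c_N) times a scaled partial isometry of infinite rank (`exists_extension_of_polynomial`). This
is always bounded, and compact exactly when c_N = 0. -/

/-! ### Gaussian moments of entire functions -/

theorem isFiniteMeasure_fockMeasure {m : ℝ} (hm : 0 < m) : IsFiniteMeasure (fockMeasure m) := by
  have h := memLp_monomial hm 0 0
  simp only [pow_zero, mul_one] at h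
  rw [memLp_const_iff (by norm_num) (by norm_num)] at h
  exact ⟨by simpa using h⟩

theorem setIntegral_fockMeasure (m : ℝ) {s : Set ℂ} (hs : MeasurableSet s) (F : ℂ → ℂ) :
    ∫ z in s, F z ∂fockMeasure m =
      ∫ z in s, (Real.pi⁻¹ * Real.exp (-m * ‖z‖ ^ 2)) • F z := by
  rw [fockMeasure, restrict_withDensity hs,
    integral_withDensity_eq_integral_toReal_smul (by fun_prop) (by simp)]
  refine integral_congr_ae (Filter.Eventually.of_forall fun z => ?_)
  simp only
  rw [ENNReal.toReal_ofReal (by positivity)]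

/-- Monomials of nonzero weight have mean zero over centred disks. -/
theorem setIntegral_ball_monomial_eq_zero (m R : ℝ) {p q : ℕ} (hpq : p ≠ q) :
    ∫ z in Metric.ball (0 : ℂ) R, z ^ p * conj z ^ q ∂fockMeasure m = 0 := by
  rw [setIntegral_fockMeasure m measurableSet_ball]
  -- Rotation by this angle multiplies z^p z̄^q by exp(iπ) = -1 and preserves both the disk and the
  -- weight, so the integral equals its own negative.
  set t : ℝ := Real.pi / ((p : ℝ) - q) with ht
  have hpq' : (p : ℝ) - q ≠ 0 := by
    rw [sub_ne_zero]; exact_mod_cast hpq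
  set a : Circle := Circle.exp t with ha
  have haval : (a : ℂ) ^ p * conj (a : ℂ) ^ q = -1 := by
    rw [ha, Circle.coe_exp, ← Complex.exp_conj, ← Complex.exp_nat_mul, ← Complex.exp_nat_mul,
      ← Complex.exp_add, ← Complex.exp_pi_mul_I]
    congr 1
    simp only [map_mul, Complex.conj_ofReal, Complex.conj_I]
    have : (t : ℂ) * ((p : ℂ) - q) = Real.pi := by
      rw [ht]; push_cast
      rw [div_mul_cancel₀]
      exact_mod_cast hpq'
    linear_combination Complex.I * this
  have key := (rotation a).measurePreserving.setIntegral_preimage_emb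
    (rotation a).toHomeomorph.measurableEmbedding
    (fun z : ℂ => (Real.pi⁻¹ * Real.exp (-m * ‖z‖ ^ 2)) • (z ^ p * conj z ^ q))
    (Metric.ball (0 : ℂ) R)
  have hpre : (rotation a) ⁻¹' Metric.ball (0 : ℂ) R = Metric.ball (0 : ℂ) R := by
    ext z; rw [Set.mem_preimage, mem_ball_zero_iff, mem_ball_zero_iff, LinearIsometryEquiv.norm_map]
  rw [hpre] at key
  have h2 : ∀ z : ℂ, (Real.pi⁻¹ * Real.exp (-m * ‖rotation a z‖ ^ 2)) •
      ((rotation a z) ^ p * conj (rotation a z) ^ q) =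
      -((Real.pi⁻¹ * Real.exp (-m * ‖z‖ ^ 2)) • (z ^ p * conj z ^ q)) := by
    intro z
    rw [LinearIsometryEquiv.norm_map, rotation_apply, map_mul, mul_pow, mul_pow]
    rw [show (a : ℂ) ^ p * z ^ p * (conj (a : ℂ) ^ q * conj z ^ q) =
      ((a : ℂ) ^ p * conj (a : ℂ) ^ q) * (z ^ p * conj z ^ q) by ring, haval]
    simp
  simp only [h2, integral_neg] at key
  exact self_eq_neg.mp key.symm

theorem integral_normSq_pow {m : ℝ} (hm : 0 < m) (b : ℕ) :
    ∫ z : ℂ, z ^ b * conj z ^ b ∂fockMeasure m = (b.factorial / m ^ (b + 1) : ℝ) := by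
  rw [← setIntegral_univ, setIntegral_fockMeasure m MeasurableSet.univ, setIntegral_univ]
  have h := Complex.integral_rpow_mul_exp_neg_mul_rpow (p := 2) (q := 2 * b) (b := m)
    (by norm_num) (by linarith [(Nat.cast_nonneg b : (0 : ℝ) ≤ b)]) hm
  have h2 : ∀ z : ℂ, (Real.pi⁻¹ * Real.exp (-m * ‖z‖ ^ 2)) • (z ^ b * conj z ^ b) =
      ((Real.pi⁻¹ * (‖z‖ ^ (2 * b : ℝ) * Real.exp (-m * ‖z‖ ^ (2 : ℝ))) : ℝ) : ℂ) := by
    intro z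
    rw [← mul_pow, Complex.mul_conj, Complex.normSq_eq_norm_sq, Complex.real_smul,
      show (2 * b : ℝ) = ((2 * b : ℕ) : ℝ) by push_cast; ring, Real.rpow_natCast, pow_mul,
      Real.rpow_two]
    push_cast
    ring
  simp only [h2]
  rw [integral_complex_ofReal, integral_const_mul, h]
  congr 1
  rw [show ((2 * b : ℝ) + 2) / 2 = b + 1 by ring, Real.Gamma_nat_eq_factorial,
    show -((2 * b : ℝ) + 2) / 2 = -((b + 1 : ℕ) : ℝ) by push_cast; ring, Real.rpow_neg hm.le,
    Real.rpow_natCast]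
  field_simp

/-- The moments of an entire function against `z̄ ^ b` pick out one Taylor coefficient. -/
theorem integral_entire_mul_monomial {m : ℝ} (hm : 0 < m) {g : ℂ → ℂ} {c : ℕ → ℂ}
    (hc : ∀ z, HasSum (fun n => c n * z ^ n) (g z))
    (hg : ∀ n : ℕ, MemLp (fun z => z ^ n * g z) 2 (fockMeasure m)) (a b : ℕ) :
    ∫ z, g z * (z ^ a * conj z ^ b) ∂fockMeasure m =
      if a ≤ b then c (b - a) * (b.factorial / m ^ (b + 1) : ℝ) else 0 := by
  have := isFiniteMeasure_fockMeasure hm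
  have hint : Integrable (fun z => g z * (z ^ a * conj z ^ b)) (fockMeasure m) := by
    have h := (memLp_monomial hm b 0).integrable_mul (hg a)
    refine h.congr (Filter.Eventually.of_forall fun z => ?_)
    simp only [Pi.mul_apply]; ring
  have hintb : Integrable (fun z : ℂ => z ^ b * conj z ^ b) (fockMeasure m) := by
    have h := (memLp_monomial hm b 0).integrable_mul (memLp_monomial hm 0 b)
    refine h.congr (Filter.Eventually.of_forall fun z => ?_)
    simp only [Pi.mul_apply]; ring
  -- The Taylor series is integrated term by term over disks, where it converges uniformly; the
  -- radius then tends to infinity.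
  have hlim : ∀ F : ℂ → ℂ, Integrable F (fockMeasure m) → Filter.Tendsto
      (fun n : ℕ => ∫ z in Metric.ball (0 : ℂ) n, F z ∂fockMeasure m) Filter.atTop
      (nhds (∫ z, F z ∂fockMeasure m)) := by
    intro F hF
    have h := tendsto_setIntegral_of_monotone (μ := fockMeasure m) (f := F)
      (s := fun n : ℕ => Metric.ball (0 : ℂ) n) (fun _ => measurableSet_ball)
      (fun i j hij => Metric.ball_subset_ball (by exact_mod_cast hij)) hF.integrableOn
    rwa [Metric.iUnion_ball_nat, setIntegral_univ] at h
  have hball : ∀ R : ℕ, ∫ z in Metric.ball (0 : ℂ) R, g z * (z ^ a * conj z ^ b) ∂fockMeasure m =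
      (if a ≤ b then c (b - a) else 0) *
        ∫ z in Metric.ball (0 : ℂ) R, z ^ b * conj z ^ b ∂fockMeasure m := by
    intro R
    have hcont : ∀ k, Continuous fun z : ℂ => c k * z ^ k * (z ^ a * conj z ^ b) := fun k => by
      fun_prop
    have hbd : ∀ k, ∀ᵐ z ∂(fockMeasure m).restrict (Metric.ball (0 : ℂ) R),
        ‖c k * z ^ k * (z ^ a * conj z ^ b)‖ ≤ ‖c k‖ * (R : ℝ) ^ k * ((R : ℝ) ^ a * (R : ℝ) ^ b) := by
      intro k
      filter_upwards [ae_restrict_mem measurableSet_ball] with z hz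
      have hz' : ‖z‖ ≤ R := by simpa using (mem_ball_zero_iff.mp hz).le
      simp only [norm_mul, norm_pow, RCLike.norm_conj]
      gcongr
    have hi : ∀ k, Integrable (fun z : ℂ => c k * z ^ k * (z ^ a * conj z ^ b))
        ((fockMeasure m).restrict (Metric.ball (0 : ℂ) R)) := fun k =>
      Integrable.of_bound (hcont k).aestronglyMeasurable _ (hbd k)
    have hsum : Summable fun k => ∫ z in Metric.ball (0 : ℂ) R,
        ‖c k * z ^ k * (z ^ a * conj z ^ b)‖ ∂fockMeasure m := by
      -- Absolute convergence at the point z = R dominates the series on the whole disk.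
      have h1 : Summable fun k => ‖c k‖ * (R : ℝ) ^ k := by
        simpa using (hc R).summable.norm
      refine Summable.of_nonneg_of_le (fun k => integral_nonneg fun z => norm_nonneg _)
        (fun k => ?_) ((h1.mul_right ((R : ℝ) ^ a * (R : ℝ) ^ b)).mul_right
          (((fockMeasure m).restrict (Metric.ball (0 : ℂ) R)).real Set.univ))
      calc _ ≤ ∫ z in Metric.ball (0 : ℂ) R,
          ‖c k‖ * (R : ℝ) ^ k * ((R : ℝ) ^ a * (R : ℝ) ^ b) ∂fockMeasure m :=
            integral_mono_ae (hi k).norm (integrable_const _) (hbd k)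
        _ = _ := by rw [integral_const, smul_eq_mul, mul_comm]
    have h := hasSum_integral_of_summable_integral_norm hi hsum
    have e1 : ∀ z, ∑' k, c k * z ^ k * (z ^ a * conj z ^ b) = g z * (z ^ a * conj z ^ b) :=
      fun z => ((hc z).mul_right _).tsum_eq
    simp only [e1] at h
    have e2 : ∀ k, ∫ z in Metric.ball (0 : ℂ) R, c k * z ^ k * (z ^ a * conj z ^ b) ∂fockMeasure m
        = c k * ∫ z in Metric.ball (0 : ℂ) R, z ^ (k + a) * conj z ^ b ∂fockMeasure m := by
      intro k
      rw [← integral_const_mul]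
      congr 1; ext z; ring
    simp only [e2] at h
    refine h.unique ?_
    -- Only the term with k + a = b has weight zero under rotations; it exists exactly when a ≤ b.
    split_ifs with hab
    · have h3 := hasSum_single (f := fun k => c k * ∫ z in Metric.ball (0 : ℂ) R,
        z ^ (k + a) * conj z ^ b ∂fockMeasure m) (b - a) fun k hk => by
          rw [setIntegral_ball_monomial_eq_zero m R (by omega), mul_zero]
      simpa [Nat.sub_add_cancel hab] using h3
    · have h0 : ∀ k, c k * ∫ z in Metric.ball (0 : ℂ) R,
          z ^ (k + a) * conj z ^ b ∂fockMeasure m = 0 := fun k => by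
        rw [setIntegral_ball_monomial_eq_zero m R (by omega), mul_zero]
      simp only [h0, zero_mul]
      exact hasSum_zero
  have h1 := hlim _ hint
  have h2 := (hlim _ hintb).const_mul (if a ≤ b then c (b - a) else 0)
  simp only [hball] at h1
  rw [tendsto_nhds_unique h1 h2, integral_normSq_pow hm, ite_mul, zero_mul]

/-! ### Laguerre vectors and the orthogonal complement of S -/

noncomputable section

/-- Differencing the rising factorial y(y+1)⋯(y+i-1) lowers its degree by one and brings down the
degree as a factor. For i < n the falling factorial vanishes, so the truncated i - n is harmless.
Over ℤ the differences are genuine. -/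
theorem fwdDiff_iterate_ascFactorial (i n : ℕ) :
    (fwdDiff 1)^[n] (fun y : ℕ => (y.ascFactorial i : ℤ)) =
      fun y => (i.descFactorial n * (y + n).ascFactorial (i - n) : ℤ) := by
  induction n with
  | zero => simp
  | succ n ih =>
    rw [Function.iterate_succ_apply', ih]
    ext y
    rw [fwdDiff, Nat.descFactorial_succ]
    rcases hk : i - n with _ | k
    · simp
    · have h1 : i - (n + 1) = k := by omega
      have h2 := Nat.succ_ascFactorial (y + n) k
      rw [h1, Nat.ascFactorial_succ, Nat.ascFactorial_succ,
        show y + 1 + n = (y + n).succ by omega, show y + (n + 1) = (y + n).succ by omega]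
      zify at h2
      push_cast
      linear_combination (-(i.descFactorial n : ℤ)) * (-h2)

theorem sum_neg_one_pow_choose_ascFactorial (i n y : ℕ) :
    ∑ j ∈ Finset.range (n + 1), ((-1 : ℝ) ^ (n - j) * n.choose j) * ((y + j).ascFactorial i : ℝ) =
      i.descFactorial n * (y + n).ascFactorial (i - n) := by
  have h := fwdDiff_iter_eq_sum_shift 1 (fun y : ℕ => (y.ascFactorial i : ℤ)) n y
  rw [fwdDiff_iterate_ascFactorial] at h
  simp only [smul_eq_mul, mul_one] at h
  have h' := congrArg (Int.cast : ℤ → ℝ) h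
  push_cast at h'
  exact h'.symm

variable {m : ℝ}

/-- The class of `z̄ ^ j * z ^ k` in `L²(μ_m)`. -/
def fockMonomial (hm : 0 < m) (j k : ℕ) : FockL2 m := (memLp_monomial hm j k).toLp

theorem inner_conjMul_fockMonomial (hm : 0 < m) {g : ℂ → ℂ} {c : ℕ → ℂ}
    (hc : ∀ z, HasSum (fun n => c n * z ^ n) (g z))
    (hg : ∀ n : ℕ, MemLp (fun z => z ^ n * g z) 2 (fockMeasure m)) (n j k : ℕ) :
    inner ℂ (conjMul hg (X ^ n)) (fockMonomial hm j k) =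
      if k ≤ n + j then c (n + j - k) * ((n + j).factorial / m ^ (n + j + 1) : ℝ) else 0 := by
  rw [← integral_entire_mul_monomial hm hc hg k (n + j), L2.inner_def]
  refine integral_congr_ae ?_
  filter_upwards [(memLp_conj_mul_polynomial hg (X ^ n)).coeFn_toLp,
    (memLp_monomial hm j k).coeFn_toLp] with z h1 h2
  change inner ℂ ((memLp_conj_mul_polynomial hg (X ^ n)).toLp _ z)
    ((memLp_monomial hm j k).toLp _ z) = _
  rw [h1, h2]
  simp
  ring

theorem inner_fockMonomial (hm : 0 < m) (a b j k : ℕ) :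
    inner ℂ (fockMonomial hm a b) (fockMonomial hm j k) =
      if a + k = b + j then (((b + j).factorial / m ^ (b + j + 1) : ℝ) : ℂ) else 0 := by
  -- The moment formula is applied to the constant function 1.
  have hc : ∀ z : ℂ, HasSum (fun n => (Pi.single 0 1 : ℕ → ℂ) n * z ^ n) ((fun _ => 1 : ℂ → ℂ) z) := by
    intro z
    have h := hasSum_single (f := fun n => (Pi.single 0 1 : ℕ → ℂ) n * z ^ n) 0
      fun n hn => by simp [hn]
    simpa using h
  have h := integral_entire_mul_monomial hm hc
    (fun n => by simpa using memLp_monomial hm 0 n) (a + k) (b + j)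
  have h2 : inner ℂ (fockMonomial hm a b) (fockMonomial hm j k) =
      ∫ z : ℂ, 1 * (z ^ (a + k) * conj z ^ (b + j)) ∂fockMeasure m := by
    rw [L2.inner_def]
    refine integral_congr_ae ?_
    filter_upwards [(memLp_monomial hm a b).coeFn_toLp,
      (memLp_monomial hm j k).coeFn_toLp] with z h1 h2
    change inner ℂ ((memLp_monomial hm a b).toLp _ z) ((memLp_monomial hm j k).toLp _ z) = _
    rw [h1, h2]
    simp
    ring
  rw [h2, h]
  by_cases h3 : a + k = b + j
  · simp [h3]
  · rw [if_neg h3]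
    split_ifs with h4
    · rw [Pi.single_eq_of_ne (by omega), zero_mul]
    · rfl

/-- The coefficients of the monic Laguerre polynomial of degree `N` and parameter `l`,
rescaled to the weight `exp (-m x)`. -/
def laguerreCoeff (m : ℝ) (N l j : ℕ) : ℝ :=
  (-1) ^ (N - j) * N.choose j * ((N + l).factorial / (j + l).factorial) * (m ^ j / m ^ N)

/-- The function `z ^ l * L(|z|²)`, with `L` the rescaled monic Laguerre polynomial of
degree `N` and parameter `l`. -/
def laguerreVec (hm : 0 < m) (N l : ℕ) : FockL2 m :=
  ∑ j ∈ Finset.range (N + 1), (laguerreCoeff m N l j : ℂ) • fockMonomial hm j (j + l)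

/-- Since (i+l+j)!/(l+j)! is a rising factorial in j of degree i, the alternating binomial weights
turn the sum into an N-th finite difference. It therefore vanishes for i < N, which is Laguerre
orthogonality. -/
theorem sum_laguerreCoeff_mul (hm : 0 < m) (N l i : ℕ) :
    ∑ j ∈ Finset.range (N + 1),
      laguerreCoeff m N l j * ((i + l + j).factorial / m ^ (i + l + j + 1)) =
    (N + l).factorial / m ^ (N + i + l + 1) *
      (i.descFactorial N * (l + 1 + N).ascFactorial (i - N)) := by
  rw [← sum_neg_one_pow_choose_ascFactorial, Finset.mul_sum]
  refine Finset.sum_congr rfl fun j _ => ?_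
  have h := Nat.factorial_mul_ascFactorial (l + j) i
  have h' : ((i + l + j).factorial : ℝ) = (l + j).factorial * (l + 1 + j).ascFactorial i := by
    rw [show l + 1 + j = l + j + 1 by ring, show i + l + j = l + j + i by ring]
    exact_mod_cast h.symm
  rw [laguerreCoeff, h', show j + l = l + j by ring]
  have : ((l + j).factorial : ℝ) ≠ 0 := by positivity
  field_simp
  ring

theorem inner_fockMonomial_laguerreVec (hm : 0 < m) (N l a b : ℕ) :
    inner ℂ (fockMonomial hm a b) (laguerreVec hm N l) =
      if b = a + l then (((N + l).factorial / m ^ (N + a + l + 1) *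
        (a.descFactorial N * (l + 1 + N).ascFactorial (a - N)) : ℝ) : ℂ) else 0 := by
  rw [laguerreVec, inner_sum]
  simp only [inner_smul_right, inner_fockMonomial]
  split_ifs with h
  · subst h
    rw [← sum_laguerreCoeff_mul hm, Complex.ofReal_sum]
    refine Finset.sum_congr rfl fun j _ => ?_
    rw [if_pos (by ring), Complex.ofReal_mul]
  · refine Finset.sum_eq_zero fun j _ => ?_
    rw [if_neg (by omega), mul_zero]

/-- Every summand of the Laguerre vector has weight l, so each picks out the same Taylor coefficient
c d, and the remaining sum is the one for z̄^d z^(d+l). -/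
theorem inner_conjMul_laguerreVec (hm : 0 < m) {g : ℂ → ℂ} {c : ℕ → ℂ}
    (hc : ∀ z, HasSum (fun n => c n * z ^ n) (g z))
    (hg : ∀ n : ℕ, MemLp (fun z => z ^ n * g z) 2 (fockMeasure m)) (N l d : ℕ) :
    inner ℂ (conjMul hg (X ^ (d + l))) (laguerreVec hm N l) =
      c d * (((N + l).factorial / m ^ (N + d + l + 1) *
        (d.descFactorial N * (l + 1 + N).ascFactorial (d - N)) : ℝ) : ℂ) := by
  rw [laguerreVec, inner_sum, ← sum_laguerreCoeff_mul hm, Complex.ofReal_sum, Finset.mul_sum]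
  refine Finset.sum_congr rfl fun j _ => ?_
  rw [inner_smul_right, inner_conjMul_fockMonomial hm hc, if_pos (by omega),
    show d + l + j - (j + l) = d by omega, Complex.ofReal_mul]
  ring

/-- The generators have j < N, so the factor `j.descFactorial N` is zero; orthogonality then passes
to the closed span. -/
theorem inner_subspaceS_laguerreVec (hm : 0 < m) (N l : ℕ) {u : FockL2 m}
    (hu : u ∈ subspaceS hm N) : inner ℂ u (laguerreVec hm N l) = 0 := by
  have h : subspaceS hm N ≤ (Submodule.span ℂ {laguerreVec hm N l})ᗮ := by
    refine Submodule.topologicalClosure_minimal _ (Submodule.span_le.mpr ?_)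
      (Submodule.isClosed_orthogonal _)
    rintro _ ⟨j, k, hj, _, rfl⟩
    rw [SetLike.mem_coe, Submodule.mem_orthogonal_singleton_iff_inner_left]
    have := inner_fockMonomial_laguerreVec hm N l j k
    rw [Nat.descFactorial_of_lt hj] at this
    simpa [fockMonomial] using this
  exact (Submodule.mem_orthogonal_singleton_iff_inner_left).mp (h hu)

theorem fockMonomial_mem_subspaceS (hm : 0 < m) {N j k : ℕ} (hj : j < N) (hk : j ≤ k) :
    fockMonomial hm j k ∈ subspaceS hm N :=
  Submodule.le_topologicalClosure _ (Submodule.subset_span ⟨j, k, hj, hk, rfl⟩)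

theorem fockMonomial_sub_laguerreVec_mem (hm : 0 < m) (N l : ℕ) :
    fockMonomial hm N (N + l) - laguerreVec hm N l ∈ subspaceS hm N := by
  have h1 : laguerreCoeff m N l N = 1 := by
    have : ((N + l).factorial : ℝ) ≠ 0 := by positivity
    simp [laguerreCoeff, this, hm.ne']
  rw [laguerreVec, Finset.sum_range_succ, h1, Complex.ofReal_one, one_smul, sub_add_cancel_right]
  refine neg_mem (sum_mem fun j hj => Submodule.smul_mem _ _ ?_)
  exact fockMonomial_mem_subspaceS hm (Finset.mem_range.mp hj) (by omega)

/-- Modulo S the left vector may be replaced by its leading monomial z̄^N z^(N+l). -/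
theorem inner_laguerreVec (hm : 0 < m) (N l l' : ℕ) :
    inner ℂ (laguerreVec hm N l) (laguerreVec hm N l') =
      if l = l' then (((N + l).factorial * N.factorial / m ^ (N + N + l + 1) : ℝ) : ℂ) else 0 := by
  have h := inner_subspaceS_laguerreVec hm N l' (fockMonomial_sub_laguerreVec_mem hm N l)
  rw [inner_sub_left, sub_eq_zero] at h
  rw [← h, inner_fockMonomial_laguerreVec]
  by_cases h2 : l = l'
  · subst h2
    simp [Nat.descFactorial_self]
    ring
  · rw [if_neg h2, if_neg (by omega)]

/-- `(I - P_S)(z̄ ^ N * z ^ (N + l))` is the Laguerre vector. -/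
theorem sub_starProjection_fockMonomial (hm : 0 < m) (N l : ℕ) :
    fockMonomial hm N (N + l) - (subspaceS hm N).starProjection (fockMonomial hm N (N + l)) =
      laguerreVec hm N l := by
  rw [sub_eq_iff_eq_add, ← sub_eq_iff_eq_add']
  symm
  refine Submodule.eq_starProjection_of_mem_of_inner_eq_zero
    (fockMonomial_sub_laguerreVec_mem hm N l) fun w hw => ?_
  rw [sub_sub_cancel, ← inner_conj_symm, inner_subspaceS_laguerreVec hm N l hw, map_zero]

end

/-! ### Operators acting between orthogonal sequences -/

section HilbertSpace

variable {E F : Type*} [NormedAddCommGroup E] [InnerProductSpace ℂ E] [NormedAddCommGroup F]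
  [InnerProductSpace ℂ F]

theorem orthonormal_normalize {ι : Type*} {v : ι → E} (h0 : ∀ i, v i ≠ 0)
    (h : Pairwise fun i j => inner ℂ (v i) (v j) = 0) :
    Orthonormal ℂ fun i => ((‖v i‖ : ℂ)⁻¹) • v i := by
  refine ⟨fun i => norm_smul_inv_norm (h0 i), fun i j hij => ?_⟩
  simp only [inner_smul_left, inner_smul_right, h hij, mul_zero]

/-- Orthonormal sequences are mapped to each other by a partial isometry. -/
theorem Orthonormal.exists_partialIsometry [CompleteSpace E] [CompleteSpace F] {v : ℕ → E}
    {w : ℕ → F} (hv : Orthonormal ℂ v) (hw : Orthonormal ℂ w) :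
    ∃ U : E →L[ℂ] F, (∀ n, U (v n) = w n) ∧ ∀ x, (∀ n, inner ℂ (v n) x = 0) → U x = 0 := by
  set V := hv.orthogonalFamily.linearIsometry.toContinuousLinearMap with hV
  set W := hw.orthogonalFamily.linearIsometry.toContinuousLinearMap with hW
  have hVs : ∀ n, V (lp.single 2 n (1 : ℂ)) = v n := fun n => by
    simp [hV, hv.orthogonalFamily.linearIsometry_apply_single]
  have hWs : ∀ n, W (lp.single 2 n (1 : ℂ)) = w n := fun n => by
    simp [hW, hw.orthogonalFamily.linearIsometry_apply_single]
  have hadj : ∀ x n, (ContinuousLinearMap.adjoint V x : ℕ → ℂ) n = inner ℂ (v n) x := by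
    intro x n
    rw [← hVs, ← ContinuousLinearMap.adjoint_inner_right, lp.inner_single_left]
    simp
  -- V and W embed ℓ² isometrically along the two sequences, so W V* carries one to the other and
  -- kills the complement of the first.
  refine ⟨W ∘L ContinuousLinearMap.adjoint V, fun n => ?_, fun x hx => ?_⟩
  · rw [ContinuousLinearMap.comp_apply, ← hWs]
    congr 1
    ext k
    rw [hadj, orthonormal_iff_ite.mp hv]
    by_cases h : k = n
    · subst h; simp
    · simp [h]
  · rw [ContinuousLinearMap.comp_apply]
    convert map_zero W
    ext k
    rw [hadj, hx k]
    rfl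

theorem exists_clm_of_orthogonal [CompleteSpace E] [CompleteSpace F] {v : ℕ → E} {w : ℕ → F}
    (hv0 : ∀ i, v i ≠ 0) (hv : Pairwise fun i j => inner ℂ (v i) (v j) = 0)
    (hw0 : ∀ i, w i ≠ 0) (hw : Pairwise fun i j => inner ℂ (w i) (w j) = 0)
    {s : ℝ} (hs : ∀ i, ‖w i‖ = s * ‖v i‖) :
    ∃ U : E →L[ℂ] F, (∀ n, U (v n) = w n) ∧ ∀ x, (∀ n, inner ℂ (v n) x = 0) → U x = 0 := by
  obtain ⟨U, hU, hU0⟩ :=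
    (orthonormal_normalize hv0 hv).exists_partialIsometry (orthonormal_normalize hw0 hw)
  refine ⟨(s : ℂ) • U, fun n => ?_, fun x hx => ?_⟩
  · have h := hU n
    have hvn : (‖v n‖ : ℂ) ≠ 0 := by simpa using hv0 n
    have hwn : (‖w n‖ : ℂ) ≠ 0 := by simpa using hw0 n
    rw [map_smul, inv_smul_eq_iff₀ hvn, smul_smul] at h
    rw [smul_apply, h, smul_smul]
    convert one_smul ℂ (w n)
    have := hs n
    rw [← mul_assoc, ← Complex.ofReal_mul, ← this, mul_inv_cancel₀ hwn]
  · rw [smul_apply, hU0 x fun n => by rw [inner_smul_left, hx, mul_zero],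
      smul_zero]

/-- After normalization, unit vectors are sent to b times an orthonormal sequence, where b = a s.
Its terms are √2 ‖b‖ apart, so no subsequence is Cauchy unless b = 0. -/
theorem IsCompactOperator.eq_zero_of_apply_eq_smul_orthogonal {T : E →L[ℂ] F}
    (hT : IsCompactOperator T) {v : ℕ → E} {w : ℕ → F} (hv0 : ∀ i, v i ≠ 0) (hw0 : ∀ i, w i ≠ 0)
    (hw : Pairwise fun i j => inner ℂ (w i) (w j) = 0) {s : ℝ} (hs : ∀ i, ‖w i‖ = s * ‖v i‖)
    {a : ℂ} (ha : ∀ i, T (v i) = a • w i) : a = 0 := by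
  by_contra ha0
  have hs0 : s ≠ 0 := by
    rintro rfl
    exact hw0 0 (by simpa using hs 0)
  set b : ℂ := a * s with hb
  have hb0 : b ≠ 0 := mul_ne_zero ha0 (by exact_mod_cast hs0)
  have hon := orthonormal_normalize hw0 hw
  have hT' : ∀ i, T (((‖v i‖ : ℂ)⁻¹) • v i) = b • (((‖w i‖ : ℂ)⁻¹) • w i) := by
    intro i
    have hvn : (‖v i‖ : ℂ) ≠ 0 := by simpa using hv0 i
    have hs0' : (s : ℂ) ≠ 0 := by exact_mod_cast hs0
    rw [map_smul, ha, smul_smul, smul_smul, hs, hb]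
    congr 1
    push_cast
    field_simp
  have hK := hT.isCompact_closure_image_closedBall 1
  obtain ⟨y, -, φ, hφ, hlim⟩ := hK.tendsto_subseq
    (x := fun i => b • (((‖w i‖ : ℂ)⁻¹) • w i)) fun i => by
      refine subset_closure ⟨_, ?_, hT' i⟩
      rw [mem_closedBall_zero_iff]
      exact (norm_smul_inv_norm (𝕜 := ℂ) (hv0 i)).le
  obtain ⟨M, hM⟩ := Metric.cauchySeq_iff.mp hlim.cauchySeq ‖b‖ (norm_pos_iff.mpr hb0)
  have h := hM M le_rfl (M + 1) (by omega)
  simp only [Function.comp_apply] at h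
  rw [dist_eq_norm, ← smul_sub, norm_smul] at h
  -- The squared distance of two orthonormal vectors is 2, while the Cauchy estimate makes their
  -- distance less than 1.
  have h1 := norm_sub_sq (𝕜 := ℂ) (((‖w (φ M)‖ : ℂ)⁻¹) • w (φ M))
    (((‖w (φ (M + 1))‖ : ℂ)⁻¹) • w (φ (M + 1)))
  have h2 := hon.2 (hφ (Nat.lt_succ_self M)).ne
  simp only [Nat.succ_eq_add_one] at h2
  have h3 := hon.1 (φ M)
  have h4 := hon.1 (φ (M + 1))
  simp only at h3 h4
  rw [h2, h3, h4, map_zero] at h1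
  have h5 := lt_of_mul_lt_mul_left (h.trans_eq (mul_one _).symm) (norm_nonneg b)
  nlinarith [norm_nonneg (((‖w (φ M)‖ : ℂ)⁻¹) • w (φ M) -
    ((‖w (φ (M + 1))‖ : ℂ)⁻¹) • w (φ (M + 1)))]

end HilbertSpace

/-! ### Norms of the monomials and of the Laguerre vectors -/

section Fock

variable {m : ℝ}

theorem norm_sq_eq_of_inner_self {E : Type*} [NormedAddCommGroup E] [InnerProductSpace ℂ E]
    {x : E} {r : ℝ} (h : inner ℂ x x = (r : ℂ)) : ‖x‖ ^ 2 = r := by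
  rw [inner_self_eq_norm_sq_to_K] at h
  exact Complex.ofReal_injective (by push_cast; exact h)

theorem norm_sq_fockMonomial (hm : 0 < m) (n : ℕ) :
    ‖fockMonomial hm 0 n‖ ^ 2 = n.factorial / m ^ (n + 1) := by
  apply norm_sq_eq_of_inner_self
  rw [inner_fockMonomial, if_pos (by ring), add_zero]

theorem norm_sq_laguerreVec (hm : 0 < m) (N l : ℕ) :
    ‖laguerreVec hm N l‖ ^ 2 = (N + l).factorial * N.factorial / m ^ (N + N + l + 1) := by
  apply norm_sq_eq_of_inner_self
  rw [inner_laguerreVec, if_pos rfl]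

/-- The ratio is free of l: this gives boundedness in degree N and, at the same time, rules out
compactness. -/
theorem norm_laguerreVec (hm : 0 < m) (N l : ℕ) :
    ‖laguerreVec hm N l‖ = √(N.factorial / m ^ N) * ‖fockMonomial hm 0 (N + l)‖ := by
  rw [← sq_eq_sq₀ (norm_nonneg _) (by positivity), mul_pow, Real.sq_sqrt (by positivity),
    norm_sq_laguerreVec, norm_sq_fockMonomial]
  field_simp
  ring

theorem fockMonomial_ne_zero (hm : 0 < m) (n : ℕ) : fockMonomial hm 0 n ≠ 0 := by
  intro h
  have h2 := norm_sq_fockMonomial hm n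
  rw [h, norm_zero] at h2
  have : 0 < (n.factorial / m ^ (n + 1) : ℝ) := by positivity
  simp at h2
  linarith

theorem laguerreVec_ne_zero (hm : 0 < m) (N l : ℕ) : laguerreVec hm N l ≠ 0 := by
  rw [← norm_pos_iff, norm_laguerreVec]
  have := norm_pos_iff.mpr (fockMonomial_ne_zero hm (N + l))
  positivity

theorem pairwise_inner_laguerreVec (hm : 0 < m) (N : ℕ) :
    Pairwise fun i j => inner ℂ (laguerreVec hm N i) (laguerreVec hm N j) = 0 :=
  fun i j hij => by simp only [inner_laguerreVec, if_neg hij]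

theorem coe_polyToFock_X_pow (hm : 0 < m) (n : ℕ) :
    (polyToFock hm (X ^ n) : FockL2 m) = fockMonomial hm 0 n :=
  MemLp.toLp_congr (memLp_polynomial hm (X ^ n)) (memLp_monomial hm 0 n)
    (Filter.Eventually.of_forall fun z => by simp)

/-! ### The middle Hankel operator on monomials -/

variable {g : ℂ → ℂ} {hg : ∀ n : ℕ, MemLp (fun z => z ^ n * g z) 2 (fockMeasure m)}

theorem middleHankel_apply (hm : 0 < m) (N : ℕ) (p : ℂ[X]) :
    middleHankel hm N hg p =
      conjMul hg p - (subspaceS hm N).starProjection (conjMul hg p) := rfl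

theorem inner_middleHankel_laguerreVec (hm : 0 < m) (N l : ℕ) (p : ℂ[X]) :
    inner ℂ (middleHankel hm N hg p) (laguerreVec hm N l) =
      inner ℂ (conjMul hg p) (laguerreVec hm N l) := by
  rw [middleHankel_apply, inner_sub_left, inner_subspaceS_laguerreVec hm N l
    (Submodule.starProjection_apply_mem _ _), sub_zero]

/-- The Taylor coefficients of degree larger than `N` vanish if the middle Hankel operator
is bounded. -/
theorem coeff_eq_zero_of_extendsToBounded (hm : 0 < m) {N : ℕ} {c : ℕ → ℂ}
    (hc : ∀ z, HasSum (fun n => c n * z ^ n) (g z))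
    (h : ExtendsToBounded hm (middleHankel hm N hg)) {d : ℕ} (hd : N < d) : c d = 0 := by
  obtain ⟨T, hT⟩ := h
  -- T is tested on z^(d+l) against the Laguerre vector of index l. After squaring and cancelling
  -- factorials, the rising factorial (l+N+1)⋯(l+d) remains; it has d - N ≥ 1 factors, so it is at
  -- least l.
  have key : ∀ l : ℕ, ‖c d‖ ^ 2 * l ≤ ‖T‖ ^ 2 * (N.factorial * m ^ d) := by
    intro l
    have h1 : ‖(inner ℂ (T (polyToFock hm (X ^ (d + l)))) (laguerreVec hm N l) : ℂ)‖ ≤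
        ‖T‖ * ‖fockMonomial hm 0 (d + l)‖ * ‖laguerreVec hm N l‖ := by
      refine (norm_inner_le_norm _ _).trans ?_
      gcongr
      rw [← coe_polyToFock_X_pow]
      exact T.le_opNorm _
    rw [hT, inner_middleHankel_laguerreVec, inner_conjMul_laguerreVec hm hc, norm_mul,
      Complex.norm_real, Real.norm_of_nonneg (by positivity)] at h1
    have h2 := pow_le_pow_left₀ (by positivity) h1 2
    rw [mul_pow, mul_pow (_ * _) ‖laguerreVec hm N l‖, mul_pow ‖T‖, norm_sq_fockMonomial, norm_sq_laguerreVec] at h2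
    have h3 : ((d + l).factorial : ℝ) =
        (N + l).factorial * (l + 1 + N).ascFactorial (d - N) := by
      have := Nat.factorial_mul_ascFactorial (N + l) (d - N)
      rw [show N + l + (d - N) = d + l by omega, show N + l + 1 = l + 1 + N by ring] at this
      exact_mod_cast this.symm
    have h4 : (1 : ℝ) ≤ d.descFactorial N := by
      exact_mod_cast Nat.pos_of_ne_zero fun h0 => by
        rw [Nat.descFactorial_eq_zero_iff_lt] at h0; omega
    have h5 : (l : ℝ) ≤ (l + 1 + N).ascFactorial (d - N) := by
      have h6 := Nat.pow_succ_le_ascFactorial (l + 1 + N) (d - N)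
      have h7 := Nat.le_self_pow (n := d - N) (by omega) (l + 1 + N)
      exact_mod_cast (by omega : l ≤ (l + 1 + N).ascFactorial (d - N))
    rw [h3] at h2
    set A : ℝ := ((l + 1 + N).ascFactorial (d - N) : ℝ) with hA
    set D : ℝ := (d.descFactorial N : ℝ)
    set K : ℝ := ((N + l).factorial : ℝ) with hK
    have hApos : 0 < A := by
      rw [hA, show l + 1 + N = l + N + 1 by ring]
      exact_mod_cast Nat.ascFactorial_pos _ _
    have hKpos : 0 < K := by positivity
    have h8 : ‖c d‖ ^ 2 * A * D ^ 2 ≤ ‖T‖ ^ 2 * (N.factorial * m ^ d) := by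
      have h9 : ‖c d‖ ^ 2 * (K / m ^ (N + d + l + 1) * (D * A)) ^ 2 =
          (‖c d‖ ^ 2 * A * D ^ 2) * (K ^ 2 * A / (m ^ (N + d + l + 1)) ^ 2) := by
        field_simp
      have h10 : ‖T‖ ^ 2 * (K * A / m ^ (d + l + 1)) * (K * N.factorial / m ^ (N + N + l + 1)) =
          (‖T‖ ^ 2 * (N.factorial * m ^ d)) * (K ^ 2 * A / (m ^ (N + d + l + 1)) ^ 2) := by
        field_simp
        ring
      rw [h9, h10] at h2
      exact le_of_mul_le_mul_right h2 (by positivity)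
    calc ‖c d‖ ^ 2 * l ≤ ‖c d‖ ^ 2 * A := by gcongr
      _ ≤ ‖c d‖ ^ 2 * A * D ^ 2 := le_mul_of_one_le_right (by positivity) (one_le_pow₀ h4)
      _ ≤ _ := h8
  by_contra h0
  have hpos : 0 < ‖c d‖ ^ 2 := by positivity
  obtain ⟨l, hl⟩ := exists_nat_gt (‖T‖ ^ 2 * (N.factorial * m ^ d) / ‖c d‖ ^ 2)
  rw [div_lt_iff₀ hpos] at hl
  linarith [key l]

theorem exists_polynomial_of_coeff_eq_zero {c : ℕ → ℂ}
    (hc : ∀ z, HasSum (fun n => c n * z ^ n) (g z)) {K : ℕ} (h : ∀ d, K ≤ d → c d = 0) :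
    ∃ p : ℂ[X], p.degree < K ∧ ∀ z, g z = p.eval z := by
  have hp : (∑ i ∈ Finset.range K, monomial i (c i)).coeff = c := by
    ext n
    simp only [finsetSum_coeff, coeff_monomial]
    rw [Finset.sum_ite_eq']
    split_ifs with hn
    · rfl
    · exact (h n (by simpa using hn)).symm
  refine ⟨∑ i ∈ Finset.range K, monomial i (c i), ?_, fun z => ?_⟩
  · rw [degree_lt_iff_coeff_zero, hp]
    exact h
  · simp only [eval_finsetSum, eval_monomial]
    refine (hc z).unique (hasSum_sum_of_ne_finset_zero fun n hn => ?_)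
    rw [h n (by simpa using hn), zero_mul]

theorem Polynomial.hasSum_coeff_mul_pow (p : ℂ[X]) (z : ℂ) :
    HasSum (fun n => p.coeff n * z ^ n) (p.eval z) := by
  rw [eval_eq_sum_range]
  refine hasSum_sum_of_ne_finset_zero fun n hn => ?_
  rw [coeff_eq_zero_of_natDegree_lt (by simpa using hn), zero_mul]

theorem toLp_sum_fockMonomial (hm : 0 < m) (a : ℕ → ℂ) (n : ℕ) (s : Finset ℕ)
    (h : MemLp (fun z : ℂ => ∑ j ∈ s, a j * (conj z ^ j * z ^ n)) 2 (fockMeasure m)) :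
    h.toLp = ∑ j ∈ s, a j • fockMonomial hm j n := by
  induction s using Finset.induction_on with
  | empty =>
    rw [Finset.sum_empty]
    exact (MemLp.toLp_congr h MemLp.zero (Filter.Eventually.of_forall fun z => by simp)).trans
      (MemLp.toLp_zero _)
  | insert i s hi ih =>
    have h1 : MemLp (fun z : ℂ => ∑ j ∈ s, a j * (conj z ^ j * z ^ n)) 2 (fockMeasure m) :=
      memLp_finsetSum _ fun j _ => (memLp_monomial hm j n).const_mul (a j)
    rw [Finset.sum_insert hi, ← ih h1, fockMonomial, ← MemLp.toLp_const_smul, ← MemLp.toLp_add]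
    exact MemLp.toLp_congr _ _ (Filter.Eventually.of_forall fun z => by
      simp [Finset.sum_insert hi])

theorem conjMul_X_pow_of_polynomial (hm : 0 < m) {p : ℂ[X]} {K : ℕ} (hp : p.degree < K)
    (hgp : ∀ z, g z = p.eval z) (n : ℕ) :
    conjMul hg (X ^ n) = ∑ j ∈ Finset.range K, conj (p.coeff j) • fockMonomial hm j n := by
  rw [← toLp_sum_fockMonomial hm _ _ _
    (memLp_finsetSum _ fun j _ => (memLp_monomial hm j n).const_mul (conj (p.coeff j)))]
  refine MemLp.toLp_congr (memLp_conj_mul_polynomial hg (X ^ n)) _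
    (Filter.Eventually.of_forall fun z => ?_)
  have h : p.eval z = ∑ j ∈ Finset.range K, p.coeff j * z ^ j := by
    refine (p.hasSum_coeff_mul_pow z).unique (hasSum_sum_of_ne_finset_zero fun j hj => ?_)
    rw [(degree_lt_iff_coeff_zero p K).mp hp j (by simpa using hj), zero_mul]
  simp only [hgp, h, map_sum, map_mul, map_pow, eval_pow, eval_X, Finset.sum_mul, mul_assoc]

/-- For `g` a polynomial of degree at most `N`, the middle Hankel operator maps the monomials
of degree at least `N` to multiples of the Laguerre vectors. -/
theorem middleHankel_X_pow_of_polynomial (hm : 0 < m) {N : ℕ} {p : ℂ[X]} (hp : p.degree ≤ N)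
    (hgp : ∀ z, g z = p.eval z) (l : ℕ) :
    middleHankel hm N hg (X ^ (N + l)) = conj (p.coeff N) • laguerreVec hm N l := by
  have hp' : p.degree < (N + 1 : ℕ) := hp.trans_lt (by exact_mod_cast Nat.lt_succ_self N)
  -- The terms with j < N lie in S because j ≤ N + l, so I - P_S only sees the term j = N.
  rw [middleHankel_apply, conjMul_X_pow_of_polynomial hm hp' hgp, Finset.sum_range_succ, map_add,
    map_smul, (Submodule.starProjection_eq_self_iff
      (v := ∑ j ∈ Finset.range N, conj (p.coeff j) • fockMonomial hm j (N + l))).mpr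
      (sum_mem fun j hj => Submodule.smul_mem _ _ (fockMonomial_mem_subspaceS hm
        (Finset.mem_range.mp hj) ((Finset.mem_range.mp hj).le.trans (Nat.le_add_right _ _)))),
    add_sub_add_left_eq_sub, ← smul_sub, sub_starProjection_fockMonomial]

/-- Each summand factors through the locally compact space ℂ. -/
theorem isCompactOperator_sum_rankOne {E F : Type*} [NormedAddCommGroup E] [InnerProductSpace ℂ E]
    [NormedAddCommGroup F] [InnerProductSpace ℂ F] (s : Finset ℕ) (x : ℕ → F) (y : ℕ → E) :
    IsCompactOperator (∑ k ∈ s, InnerProductSpace.rankOne ℂ (x k) (y k) : E →L[ℂ] F) := by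
  refine Finset.sum_induction _ (fun T : E →L[ℂ] F => IsCompactOperator T)
    (fun S T hS hT => hS.add hT) isCompactOperator_zero fun k _ => ?_
  exact (isCompactOperator_of_locallyCompactSpace_rng
    (ContinuousLinearMap.toSpanSingleton ℂ (x k))).comp_clm (innerSL ℂ (y k))

/-- For `g` a polynomial of degree at most `N`, the middle Hankel operator is a finite rank
operator plus a multiple of a partial isometry. -/
theorem exists_extension_of_polynomial (hm : 0 < m) {N : ℕ} {p : ℂ[X]} (hp : p.degree ≤ N)
    (hgp : ∀ z, g z = p.eval z) :
    ∃ R U : fockSpace m →L[ℂ] FockL2 m, IsCompactOperator R ∧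
      ∀ q, (R + conj (p.coeff N) • U) (polyToFock hm q) = middleHankel hm N hg q := by
  have hmono : ∀ i j, i ≠ j → inner ℂ (fockMonomial hm 0 i) (fockMonomial hm 0 j) = 0 :=
    fun i j hij => by rw [inner_fockMonomial, if_neg (by omega)]
  obtain ⟨U, hU, hU0⟩ := exists_clm_of_orthogonal
    (v := fun l => fockMonomial hm 0 (N + l)) (fun l => fockMonomial_ne_zero hm (N + l))
    (fun i j hij => hmono _ _ (by omega)) (laguerreVec_ne_zero hm N)
    (pairwise_inner_laguerreVec hm N) (norm_laguerreVec hm N)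
  -- R reproduces H on the finitely many monomials of degree less than N, where the values of H need
  -- no computation; the inverse squared norms compensate for the monomials not being unit vectors.
  set R : FockL2 m →L[ℂ] FockL2 m := ∑ k ∈ Finset.range N, InnerProductSpace.rankOne ℂ
    (((‖fockMonomial hm 0 k‖ : ℂ) ^ 2)⁻¹ • middleHankel hm N hg (X ^ k)) (fockMonomial hm 0 k)
    with hR
  have hRapp : ∀ n, R (fockMonomial hm 0 n) =
      if n < N then middleHankel hm N hg (X ^ n) else 0 := by
    intro n
    simp only [hR, sum_apply, InnerProductSpace.rankOne_apply]
    split_ifs with hn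
    · rw [Finset.sum_eq_single_of_mem n (Finset.mem_range.mpr hn) fun k _ hk => by
        rw [hmono k n hk, zero_smul], inner_self_eq_norm_sq_to_K, smul_smul]
      have : (‖fockMonomial hm 0 n‖ : ℂ) ≠ 0 := by simpa using fockMonomial_ne_zero hm n
      convert one_smul ℂ _
      exact mul_inv_cancel₀ (pow_ne_zero 2 this)
    · exact Finset.sum_eq_zero fun k hk => by
        rw [hmono k n (by have := Finset.mem_range.mp hk; omega), zero_smul]
  -- Both operators are built on all of L²(μ_m), which is complete, and then restricted, so
  -- completeness of F_m is not needed.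
  refine ⟨R ∘L (fockSpace m).subtypeL, U ∘L (fockSpace m).subtypeL,
    (isCompactOperator_sum_rankOne _ _ _).comp_clm _, fun q => ?_⟩
  suffices h : (((R ∘L (fockSpace m).subtypeL + conj (p.coeff N) • (U ∘L (fockSpace m).subtypeL) :
      fockSpace m →L[ℂ] FockL2 m) : fockSpace m →ₗ[ℂ] FockL2 m) ∘ₗ polyToFock hm) =
      middleHankel hm N hg from congrArg (fun f => f q) h
  refine Polynomial.lhom_ext' fun n => LinearMap.ext_ring ?_
  have hX : (monomial n (1 : ℂ)) = X ^ n := (X_pow_eq_monomial n).symm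
  change R (polyToFock hm (monomial n 1) : FockL2 m) + conj (p.coeff N) •
    U (polyToFock hm (monomial n 1) : FockL2 m) = middleHankel hm N hg (monomial n 1)
  rw [hX, coe_polyToFock_X_pow, hRapp]
  split_ifs with hn
  · rw [hU0 _ fun l => hmono _ _ (by omega), smul_zero, add_zero]
  · obtain ⟨l, rfl⟩ := Nat.exists_eq_add_of_le (not_lt.mp hn)
    rw [hU l, zero_add, middleHankel_X_pow_of_polynomial hm hp hgp]

theorem coeff_eq_zero_of_extendsToCompact (hm : 0 < m) {N : ℕ} {p : ℂ[X]} (hp : p.degree ≤ N)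
    (hgp : ∀ z, g z = p.eval z) (h : ExtendsToCompact hm (middleHankel hm N hg)) :
    p.coeff N = 0 := by
  obtain ⟨T, hT, hTc⟩ := h
  have hcoe : ∀ l, ‖polyToFock hm (X ^ (N + l))‖ = ‖fockMonomial hm 0 (N + l)‖ := fun l => by
    rw [← coe_polyToFock_X_pow, Submodule.coe_norm]
  have h := hTc.eq_zero_of_apply_eq_smul_orthogonal (v := fun l => polyToFock hm (X ^ (N + l)))
    (w := laguerreVec hm N) (a := conj (p.coeff N))
    (fun l => norm_pos_iff.mp (by
      rw [hcoe]; exact norm_pos_iff.mpr (fockMonomial_ne_zero hm (N + l))))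
    (laguerreVec_ne_zero hm N) (pairwise_inner_laguerreVec hm N)
    (fun l => by rw [hcoe]; exact norm_laguerreVec hm N l)
    (fun l => by rw [hT, middleHankel_X_pow_of_polynomial hm hp hgp])
  simpa using h

end Fock

/-! ### The characterization of bounded and compact middle Hankel operators -/

theorem corollary1 (m : ℝ) (hm : 0 < m) (N : ℕ) (hN : 1 ≤ N) (g : ℂ → ℂ)
    (hg : Differentiable ℂ g)
    (hgL2 : ∀ n : ℕ, MemLp (fun z => z ^ n * g z) 2 (fockMeasure m)) :
    (ExtendsToBounded hm (middleHankel hm N hgL2) ↔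
      ∃ p : ℂ[X], p.degree ≤ N ∧ ∀ z : ℂ, g z = p.eval z) ∧
    (ExtendsToCompact hm (middleHankel hm N hgL2) ↔
      ∃ p : ℂ[X], p.degree < N ∧ ∀ z : ℂ, g z = p.eval z) := by
  have hc : ∀ z, HasSum (fun n : ℕ => (n.factorial : ℂ)⁻¹ * iteratedDeriv n g 0 * z ^ n) (g z) := by
    intro z
    have h := Complex.hasSum_taylorSeries_of_entire hg 0 z
    simp only [sub_zero, smul_eq_mul] at h
    have e : (fun n : ℕ => (n.factorial : ℂ)⁻¹ * iteratedDeriv n g 0 * z ^ n) =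
        fun n => (n.factorial : ℂ)⁻¹ * (z ^ n * iteratedDeriv n g 0) := funext fun n => by ring
    rwa [e]
  have hbdd : ExtendsToBounded hm (middleHankel hm N hgL2) →
      ∃ p : ℂ[X], p.degree ≤ N ∧ ∀ z : ℂ, g z = p.eval z := by
    intro h
    obtain ⟨p, hp, hgp⟩ := exists_polynomial_of_coeff_eq_zero hc (K := N + 1)
      fun d hd => coeff_eq_zero_of_extendsToBounded hm hc h hd
    refine ⟨p, (degree_le_iff_coeff_zero p N).mpr fun d hd => ?_, hgp⟩
    exact (degree_lt_iff_coeff_zero p (N + 1)).mp hp d (by exact_mod_cast hd)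
  refine ⟨⟨hbdd, ?_⟩, ?_, ?_⟩
  · rintro ⟨p, hp, hgp⟩
    obtain ⟨R, U, -, h⟩ := exists_extension_of_polynomial (hg := hgL2) hm hp hgp
    exact ⟨_, h⟩
  · intro h
    obtain ⟨p, hp, hgp⟩ := hbdd (h.imp fun T hT => hT.1)
    have h0 := coeff_eq_zero_of_extendsToCompact hm hp hgp h
    refine ⟨p, (degree_lt_iff_coeff_zero p N).mpr fun d hd => ?_, hgp⟩
    rcases hd.eq_or_lt with rfl | hd
    · exact h0
    · exact (degree_le_iff_coeff_zero p N).mp hp d (by exact_mod_cast hd)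
  · rintro ⟨p, hp, hgp⟩
    obtain ⟨R, U, hR, h⟩ := exists_extension_of_polynomial (hg := hgL2) hm hp.le hgp
    -- With vanishing N-th coefficient the partial isometry drops out and only the finite rank part
    -- is left.
    refine ⟨R, fun q => ?_, hR⟩
    have h0 : p.coeff N = 0 := (degree_lt_iff_coeff_zero p N).mp hp N le_rfl
    simpa [h0] using h q
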